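/- Let $R$ be a commutative Noetherian ring and $M$ a finitely generated $R$-module. For a prime ideal $\mathfrak p$ of $R$, let $\ell_{\mathfrak p}(M)$ denote the supremum of the lengths of those $R_{\mathfrak p}$-submodules of $M_{\mathfrak p}$ that have finite length; it is finite, and it is non-zero if and only if $\mathfrak p$ is an associated prime of $M$. The fundamental cycle of $M$ is the formal sum $\sum_{\mathfrak p\in\operatorname{Ass}(M)}\ell_{\mathfrak p}(M)\,[\mathfrak p]$ in the free abelian group on the prime ideals of $R$, and $M$ is called binary if this cycle is a sum of distinct primes (that is, every coefficient is $0$ or $1$). An embedded prime of $M$ is an associated prime of $M$ that properly contains another associated prime of $M$. **Theorem.** If $M$ is a binary $R$-module without embedded primes, then $M$ is semi-prime, that is, its annihilator $\operatorname{ann}_R(M)$ is a radical ideal, and $M$ is isomorphic, as an $R$-module, to an ideal of $R/\operatorname{ann}_R(M)$. In particular, the endomorphism ring $\operatorname{End}_R(M)$ is commutative and reduced. -/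

import Mathlib

/-- The finitistic length of a module: the supremum of the lengths of its submodules of finite
length. -/
noncomputable def finitisticLength (R : Type*) [CommRing R] (M : Type*) [AddCommGroup M]
    [Module R M] : ℕ∞ :=
  ⨆ (N : Submodule R M) (_ : Module.length R N < ⊤), Module.length R N

/-- The finitistic length of the localization `M_p`, as a module over `R_p`. -/
noncomputable def localFinitisticLength (R : Type*) [CommRing R] (M : Type*) [AddCommGroup M]
    [Module R M] (p : PrimeSpectrum R) : ℕ∞ :=
  finitisticLength (Localization.AtPrime p.asIdeal) (LocalizedModule p.asIdeal.primeCompl M)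

theorem finite_associated_primeSpectrum (R : Type*) [CommRing R] [IsNoetherianRing R]
    (M : Type*) [AddCommGroup M] [Module R M] [Module.Finite R M] :
    {p : PrimeSpectrum R | p.asIdeal ∈ associatedPrimes R M}.Finite :=
  Set.Finite.preimage (fun _ _ _ _ h => PrimeSpectrum.ext h) (associatedPrimes.finite R M)

/-- The finite set of associated primes of a finitely generated module over a Noetherian ring. -/
noncomputable def assPrimes (R : Type*) [CommRing R] [IsNoetherianRing R]
    (M : Type*) [AddCommGroup M] [Module R M] [Module.Finite R M] : Finset (PrimeSpectrum R) :=
  (finite_associated_primeSpectrum R M).toFinset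

/-- The fundamental cycle `∑ ℓ(M_p) [p]` of `M`, an element of the free abelian group on the primes
of `R`; here `p` runs over the associated primes of `M` and `ℓ` is the finitistic length over
`R_p`, which is finite because `M_p` is a Noetherian module. -/
noncomputable def fundamentalCycle (R : Type*) [CommRing R] [IsNoetherianRing R]
    (M : Type*) [AddCommGroup M] [Module R M] [Module.Finite R M] : PrimeSpectrum R →₀ ℤ :=
  ∑ p ∈ assPrimes R M, Finsupp.single p ((localFinitisticLength R M p).toNat : ℤ)

/-- The cycle `∑_{p ∈ S} [p]` of a finite set of primes. -/
noncomputable def supportCycle {R : Type*} [CommRing R] (S : Finset (PrimeSpectrum R)) :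
    PrimeSpectrum R →₀ ℤ :=
  ∑ p ∈ S, Finsupp.single p 1

/-- A module is binary if its fundamental cycle is a sum of distinct primes. -/
def IsBinaryModule (R : Type*) [CommRing R] [IsNoetherianRing R]
    (M : Type*) [AddCommGroup M] [Module R M] [Module.Finite R M] : Prop :=
  ∃ S : Finset (PrimeSpectrum R), fundamentalCycle R M = supportCycle S

/-- An embedded prime of `M` is an associated prime that properly contains another one. -/
def IsEmbeddedPrime (R : Type*) [CommRing R] (M : Type*) [AddCommGroup M] [Module R M]
    (p : Ideal R) : Prop :=
  p ∈ associatedPrimes R M ∧ ∃ q ∈ associatedPrimes R M, q < p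

/-- A module is semi-prime if its annihilator is a radical ideal. -/
def IsSemiPrimeModule (R : Type*) [CommRing R] (M : Type*) [AddCommGroup M] [Module R M] : Prop :=
  (Module.annihilator R M).IsRadical

/-!
Every associated prime `p` of `M` is minimal among the associated primes, so `M_p` is supported at
the closed point of `R_p` only. Hence `M_p` has finite length
(`length_localizedModule_ne_top`), and this length is the coefficient of `p` in the fundamental
cycle. It is positive, so it is one: `M_p` is isomorphic to the residue field at `p`
(`isSimpleModule_localizedModule`). Clearing denominators, one gets a map `M → R ⧸ p` with the same
kernel as `M → M_p` (`exists_linearMap_quotient_of_isSimpleModule`).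

Since `M` embeds into the product of its localizations at associated primes, these maps to the
`R ⧸ p` are jointly injective. It follows that the annihilator of `M` is the intersection of the
associated primes, which is radical (`annihilator_eq_iInf_of_linearMaps`). As the associated primes
are pairwise incomparable, `∏ R ⧸ p` can be mapped back injectively into `R ⧸ ⋂ p`
(`exists_injective_linearMap_quotient_iInf`), which makes `M` an ideal of `R ⧸ ann M`.

An endomorphism `f` of an ideal satisfies `a * f b = f a * b` (`mul_map_end_eq_map_end_mul`). In a
reduced ring this identity forces any two endomorphisms to commute and leaves no nilpotent ones.
-/

/-! ### Localization at associated primes -/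

/-- A nonzero element of a module over a Noetherian ring survives in the localization at some
associated prime, so that `M` embeds into the product of these localizations. -/
theorem eq_zero_of_forall_associatedPrimes_mkLinearMap_eq_zero {R : Type*} [CommRing R]
    [IsNoetherianRing R] {M : Type*} [AddCommGroup M] [Module R M] (m : M)
    (h : ∀ p : PrimeSpectrum R, p.asIdeal ∈ associatedPrimes R M →
      LocalizedModule.mkLinearMap p.asIdeal.primeCompl M m = 0) : m = 0 := by
  by_contra hm
  obtain ⟨P, hP, hle⟩ := exists_le_isAssociatedPrime_of_isNoetherianRing R m hm
  have h0 := h ⟨P, hP.isPrime⟩ hP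
  have := hP.isPrime
  rw [IsLocalizedModule.eq_zero_iff P.primeCompl] at h0
  obtain ⟨s, hs⟩ := h0
  exact s.2 (hle (by simpa [Submodule.mem_colon_singleton] using! hs))

/-- A finite module over a Noetherian local ring, supported at most at the closed point, has finite
length: its prime filtration only has the residue field as a quotient. -/
theorem Module.length_ne_top_of_support_subset_closedPoint {A : Type*} [CommRing A]
    [IsNoetherianRing A] [IsLocalRing A] {N : Type*} [AddCommGroup N] [Module A N]
    [Module.Finite A N] (h : Module.support A N ⊆ {IsLocalRing.closedPoint A}) :
    Module.length A N ≠ ⊤ := by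
  have hfin : Module.Finite A N := inferInstance
  induction hfin using IsNoetherianRing.induction_on_isQuotientEquivQuotientPrime A with
  | subsingleton N => simp
  | quotient N p e =>
    have hp : p ∈ Module.support A N := by
      rw [e.support_eq, Module.support_eq_zeroLocus, PrimeSpectrum.mem_zeroLocus,
        Ideal.annihilator_quotient]
    have hp' : p.asIdeal = IsLocalRing.maximalIdeal A := by rw [h hp]; rfl
    have : IsSimpleModule A N :=
      isSimpleModule_iff_quot_maximal.mpr ⟨p.1, hp' ▸ inferInstance, ⟨e⟩⟩
    simp [Module.length_eq_one]
  | exact N₁ N₂ N₃ f g hf hg hfg h₁ h₃ =>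
    rw [Module.support_of_exact hfg hf hg, Set.union_subset_iff] at h
    rw [Module.length_eq_add_of_exact f g hf hg hfg]
    exact WithTop.add_ne_top.mpr ⟨h₁ h.1, h₃ h.2⟩

/-- Localizing at an associated prime that contains no other associated prime gives a module of
finite length. -/
theorem length_localizedModule_ne_top {R : Type*} [CommRing R] [IsNoetherianRing R]
    {M : Type*} [AddCommGroup M] [Module R M] [Module.Finite R M] (p : PrimeSpectrum R)
    (hmin : ∀ q ∈ associatedPrimes R M, q ≤ p.asIdeal → q = p.asIdeal) :
    Module.length (Localization.AtPrime p.asIdeal)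
      (LocalizedModule p.asIdeal.primeCompl M) ≠ ⊤ := by
  apply Module.length_ne_top_of_support_subset_closedPoint
  intro q hq
  obtain ⟨P, hP, hPq⟩ := Ideal.exists_minimalPrimes_le (Module.annihilator_le_of_mem_support hq)
  have hPass := Module.associatedPrimes.minimalPrimes_annihilator_subset_associatedPrimes _ _ hP
  have := hP.isPrime
  open Module.associatedPrimes in
  have hcomap :=
    comap_mem_associatedPrimes_of_mem_associatedPrimes_of_isLocalizedModule_of_fg
      p.asIdeal.primeCompl (LocalizedModule.mkLinearMap p.asIdeal.primeCompl M) P hPass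
      (IsNoetherian.noetherian _)
  have hle : P.comap (algebraMap R (Localization.AtPrime p.asIdeal)) ≤ p.asIdeal :=
    (Ideal.comap_mono (IsLocalRing.le_maximalIdeal hP.isPrime.ne_top)).trans
      (Localization.AtPrime.under_maximalIdeal (I := p.asIdeal)).le
  have heq := hmin _ hcomap hle
  have hmax : IsLocalRing.maximalIdeal (Localization.AtPrime p.asIdeal) ≤ P := by
    rw [← Localization.AtPrime.map_eq_maximalIdeal, Ideal.map_le_iff_le_comap, heq]
  exact PrimeSpectrum.ext (le_antisymm (IsLocalRing.le_maximalIdeal q.isPrime.ne_top)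
    (hmax.trans hPq))

/-! ### Coefficients of the fundamental cycle -/

theorem length_le_finitisticLength {R : Type*} [CommRing R] {M : Type*} [AddCommGroup M]
    [Module R M] (h : Module.length R M ≠ ⊤) : Module.length R M ≤ finitisticLength R M := by
  have h' : Module.length R (⊤ : Submodule R M) < ⊤ := by simpa using h.lt_top
  rw [← Module.length_top (R := R) (M := M)]
  exact le_iSup₂_of_le ⊤ h' le_rfl

theorem finitisticLength_le_length (R : Type*) [CommRing R] (M : Type*) [AddCommGroup M]
    [Module R M] : finitisticLength R M ≤ Module.length R M :=
  iSup₂_le fun N _ => Module.length_le_of_injective N.subtype N.subtype_injective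

theorem fundamentalCycle_apply {R : Type*} [CommRing R] [IsNoetherianRing R]
    {M : Type*} [AddCommGroup M] [Module R M] [Module.Finite R M] {p : PrimeSpectrum R}
    (hp : p.asIdeal ∈ associatedPrimes R M) :
    fundamentalCycle R M p = ((localFinitisticLength R M p).toNat : ℤ) := by
  classical
  have hp' : p ∈ assPrimes R M := by simpa [assPrimes] using hp
  simp [fundamentalCycle, Finsupp.finsetSum_apply, Finsupp.single_apply, hp']

theorem supportCycle_apply_le_one {R : Type*} [CommRing R] (S : Finset (PrimeSpectrum R))
    (p : PrimeSpectrum R) : supportCycle S p ≤ 1 := by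
  classical
  simp only [supportCycle, Finsupp.finsetSum_apply, Finsupp.single_apply, Finset.sum_ite_eq']
  split_ifs <;> simp

/-- If `M` is binary and its associated prime `p` contains no other one, then `M_p` has finite
length, this length is the coefficient of `p` in the fundamental cycle, and so it is one. -/
theorem isSimpleModule_localizedModule {R : Type*} [CommRing R] [IsNoetherianRing R]
    {M : Type*} [AddCommGroup M] [Module R M] [Module.Finite R M] (hbin : IsBinaryModule R M)
    {p : PrimeSpectrum R} (hp : p.asIdeal ∈ associatedPrimes R M)
    (hmin : ∀ q ∈ associatedPrimes R M, q ≤ p.asIdeal → q = p.asIdeal) :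
    IsSimpleModule (Localization.AtPrime p.asIdeal)
      (LocalizedModule p.asIdeal.primeCompl M) := by
  rw [← Module.length_eq_one_iff]
  have htop := length_localizedModule_ne_top p hmin
  have heq : localFinitisticLength R M p = Module.length (Localization.AtPrime p.asIdeal)
      (LocalizedModule p.asIdeal.primeCompl M) :=
    le_antisymm (finitisticLength_le_length _ _) (length_le_finitisticLength htop)
  have hnt : Nontrivial (LocalizedModule p.asIdeal.primeCompl M) := by
    by_contra h
    rw [not_nontrivial_iff_subsingleton] at h
    exact not_isAssociatedPrime_of_subsingleton
      (Module.associatedPrimes.mem_associatedPrimes_atPrime_of_mem_associatedPrimes hp)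
  obtain ⟨S, hS⟩ := hbin
  have hle := supportCycle_apply_le_one S p
  rw [← hS, fundamentalCycle_apply hp, heq] at hle
  have hpos := (Module.length_pos_iff (R := Localization.AtPrime p.asIdeal)
    (M := LocalizedModule p.asIdeal.primeCompl M)).mpr hnt
  -- Finiteness of the length matters here: `ENat.toNat` sends `⊤` to `0`.
  lift Module.length (Localization.AtPrime p.asIdeal)
    (LocalizedModule p.asIdeal.primeCompl M) to ℕ using htop with n
  rw [ENat.toNat_natCast] at hle
  norm_cast at hle hpos ⊢
  omega

/-! ### Maps to domains and the embedding into the quotient by the annihilator -/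

/-- The map from `R ⧸ p` to the residue field at `p` is a localization of `R`-modules at `p`. -/
theorem isLocalizedModule_quotient_residueField {R : Type*} [CommRing R] (p : Ideal R)
    [p.IsPrime] : IsLocalizedModule p.primeCompl
      (IsScalarTower.toAlgHom R (R ⧸ p) p.ResidueField).toLinearMap where
  map_units s := by
    rw [Module.End.isUnit_iff]
    have hs : algebraMap R p.ResidueField s ≠ 0 := by
      rw [Ne, ← RingHom.mem_ker, Ideal.ker_algebraMap_residueField]
      exact s.2
    refine ⟨fun x y h => ?_, fun y => ⟨(algebraMap R p.ResidueField s)⁻¹ * y, ?_⟩⟩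
    · exact mul_left_cancel₀ hs (by simpa only [Module.algebraMap_end_apply, Algebra.smul_def] using h)
    · rw [Module.algebraMap_end_apply, Algebra.smul_def, mul_inv_cancel_left₀ hs]
  surj y := by
    obtain ⟨⟨a, b⟩, h⟩ := IsLocalization.surj (nonZeroDivisors (R ⧸ p)) y
    obtain ⟨s, hs⟩ := Ideal.Quotient.mk_surjective b.1
    have hsp : s ∈ p.primeCompl := fun hsp =>
      nonZeroDivisors.ne_zero b.2 (hs ▸ Ideal.Quotient.eq_zero_iff_mem.mpr hsp)
    refine ⟨⟨a, ⟨s, hsp⟩⟩, ?_⟩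
    simp only [← hs] at h
    simpa [Algebra.smul_def, Submonoid.smul_def, mul_comm] using h
  exists_of_eq {x y} h := ⟨1, by rw [p.injective_algebraMap_quotient_residueField h]⟩

/-- If `M_p` is simple, then the map `M → M_p ≃ κ(p)` comes, up to a denominator, from a map
`M → R ⧸ p`, which therefore has the same kernel as `M → M_p`. -/
theorem exists_linearMap_quotient_of_isSimpleModule {R : Type*} [CommRing R] [IsNoetherianRing R]
    {M : Type*} [AddCommGroup M] [Module R M] [Module.Finite R M] (p : Ideal R) [p.IsPrime]
    [h : IsSimpleModule (Localization.AtPrime p) (LocalizedModule p.primeCompl M)] :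
    ∃ φ : M →ₗ[R] R ⧸ p, ∀ m, φ m = 0 → LocalizedModule.mkLinearMap p.primeCompl M m = 0 := by
  obtain ⟨I, hI, ⟨e⟩⟩ := isSimpleModule_iff_quot_maximal.mp h
  obtain rfl := IsLocalRing.eq_maximalIdeal hI
  let e' : LocalizedModule p.primeCompl M ≃ₗ[Localization.AtPrime p] p.ResidueField := e
  have := isLocalizedModule_quotient_residueField p
  have := Module.finitePresentation_of_finite R M
  obtain ⟨φ, s, hφ⟩ := Module.FinitePresentation.exists_lift_of_isLocalizedModule p.primeCompl
    (IsScalarTower.toAlgHom R (R ⧸ p) p.ResidueField).toLinearMap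
    ((e'.restrictScalars R).toLinearMap ∘ₗ LocalizedModule.mkLinearMap p.primeCompl M)
  refine ⟨φ, fun m hm => ?_⟩
  have h0 := LinearMap.congr_fun hφ m
  rw [LinearMap.comp_apply, hm, map_zero, LinearMap.smul_apply] at h0
  have h1 := IsLocalizedModule.smul_injective
    (IsScalarTower.toAlgHom R (R ⧸ p) p.ResidueField).toLinearMap s (h0.symm.trans (smul_zero s).symm)
  simpa using h1

theorem annihilator_eq_iInf_of_linearMaps {R : Type*} [CommRing R] {M : Type*} [AddCommGroup M]
    [Module R M] {ι : Type*} (P : ι → Ideal R) (hP : ∀ i, P i ∈ associatedPrimes R M)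
    (φ : ∀ i, M →ₗ[R] R ⧸ P i) (hφ : ∀ m, (∀ i, φ i m = 0) → m = 0) :
    Module.annihilator R M = ⨅ i, P i := by
  refine le_antisymm (le_iInf fun i => ?_) fun r hr => ?_
  · rw [← Submodule.annihilator_top]
    exact (hP i).annihilator_le
  · rw [Module.mem_annihilator]
    refine fun m => hφ _ fun i => ?_
    obtain ⟨x, hx⟩ := Ideal.Quotient.mk_surjective (φ i m)
    rw [map_smul, ← hx]
    exact Ideal.Quotient.eq_zero_iff_mem.mpr (Ideal.mul_mem_right x _ (Ideal.mem_iInf.mp hr i))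

/-- If jointly injective maps `φ i : M → R ⧸ P i` are given, with the primes `P i` pairwise
incomparable, then `M` embeds into `R ⧸ ⨅ i, P i`: multiply `φ i` by an element of all `P j` with
`j ≠ i` that lies outside `P i`, and add up. -/
theorem exists_injective_linearMap_quotient_iInf {R : Type*} [CommRing R] {M : Type*}
    [AddCommGroup M] [Module R M] {ι : Type*} [Fintype ι] (P : ι → Ideal R)
    (hP : ∀ i, (P i).IsPrime) (hinc : ∀ i j, P i ≤ P j → i = j) (φ : ∀ i, M →ₗ[R] R ⧸ P i)
    (hφ : ∀ m, (∀ i, φ i m = 0) → m = 0) {J : Ideal R} (hJ : J = ⨅ i, P i) :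
    ∃ ψ : M →ₗ[R] R ⧸ J, Function.Injective ψ := by
  classical
  have hc : ∀ i, ∃ c, c ∉ P i ∧ ∀ j, j ≠ i → c ∈ P j := by
    intro i
    have hnot : ¬ (Finset.univ.erase i).inf P ≤ P i := by
      rw [(hP i).inf_le']
      rintro ⟨j, hj, hji⟩
      exact Finset.ne_of_mem_erase hj (hinc j i hji)
    obtain ⟨c, hc, hci⟩ := SetLike.not_le_iff_exists.mp hnot
    refine ⟨c, hci, fun j hj => ?_⟩
    exact (Finset.inf_le (f := P) (Finset.mem_erase.mpr ⟨hj, Finset.mem_univ j⟩)) hc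
  choose c hci hcj using hc
  have hmap : ∀ i, P i ≤ Submodule.comap (LinearMap.mulLeft R (c i)) J := by
    intro i x hx
    simp only [hJ, Submodule.mem_comap, LinearMap.mulLeft_apply, Ideal.mem_iInf]
    intro j
    by_cases hji : j = i
    · subst hji; exact Ideal.mul_mem_left _ _ hx
    · exact Ideal.mul_mem_right _ _ (hcj i j hji)
  let ψ : M →ₗ[R] R ⧸ J :=
    ∑ i, (Submodule.mapQ (P i) J (LinearMap.mulLeft R (c i)) (hmap i)) ∘ₗ φ i
  refine ⟨ψ, (injective_iff_map_eq_zero ψ).mpr fun m hm => hφ m fun k => ?_⟩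
  choose r hr using fun i => Ideal.Quotient.mk_surjective (φ i m)
  have hψ : ψ m = Ideal.Quotient.mk J (∑ i, c i * r i) := by
    simp only [ψ, LinearMap.sum_apply, LinearMap.comp_apply, map_sum]
    exact Finset.sum_congr rfl fun i _ => by rw [← hr i]; rfl
  rw [hψ, Ideal.Quotient.eq_zero_iff_mem, hJ, Ideal.mem_iInf] at hm
  have hk := hm k
  rw [← Finset.add_sum_erase _ _ (Finset.mem_univ k), Ideal.add_mem_iff_left] at hk
  · rw [← hr k, Ideal.Quotient.eq_zero_iff_mem]
    exact ((hP k).mem_or_mem hk).resolve_left (hci k)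
  · exact Ideal.sum_mem _ fun i hi =>
      Ideal.mul_mem_right _ _ (hcj i k (Finset.ne_of_mem_erase hi).symm)

theorem exists_ideal_linearEquiv_of_injective {R : Type*} [CommRing R] {M : Type*}
    [AddCommGroup M] [Module R M] {J : Ideal R} (ψ : M →ₗ[R] R ⧸ J)
    (hψ : Function.Injective ψ) : ∃ I : Ideal (R ⧸ J), Nonempty (M ≃ₗ[R] I) := by
  let I : Ideal (R ⧸ J) :=
    { LinearMap.range ψ with
      smul_mem' := by
        rintro x _ ⟨m, rfl⟩
        obtain ⟨r, rfl⟩ := Ideal.Quotient.mk_surjective x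
        exact ⟨r • m, by rw [map_smul]; rfl⟩ }
  exact ⟨I, ⟨LinearEquiv.ofInjective ψ hψ⟩⟩

/-! ### Endomorphisms of ideals -/

/-- An endomorphism of an ideal is symmetric for the multiplication: if `a` and `b` are the classes
of `r` and `t`, then `r • b = t • a`, and `f` is linear. -/
theorem mul_map_end_eq_map_end_mul {R : Type*} [CommRing R] {M : Type*} [AddCommGroup M]
    [Module R M] {J : Ideal R} (ψ : M →ₗ[R] R ⧸ J) (hψ : Function.Injective ψ)
    (f : Module.End R M) (a b : M) : ψ a * ψ (f b) = ψ (f a) * ψ b := by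
  obtain ⟨r, hr⟩ := Ideal.Quotient.mk_surjective (ψ a)
  obtain ⟨t, ht⟩ := Ideal.Quotient.mk_surjective (ψ b)
  have hsmul : ∀ (x : R) (m : M), ψ (x • m) = Ideal.Quotient.mk J x * ψ m := fun x m => by
    rw [map_smul]; rfl
  have hrt : r • b = t • a := hψ (by rw [hsmul, hsmul, hr, ht, mul_comm])
  rw [← hr, ← hsmul, ← map_smul, hrt, map_smul, hsmul, ht, mul_comm]

theorem Module.End.mul_comm_of_injective_quotient {R : Type*} [CommRing R] {M : Type*}
    [AddCommGroup M] [Module R M] {J : Ideal R} (hJ : J.IsRadical) (ψ : M →ₗ[R] R ⧸ J)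
    (hψ : Function.Injective ψ) (f g : Module.End R M) : f * g = g * f := by
  have : IsReduced (R ⧸ J) := (Ideal.isRadical_iff_quotient_reduced J).mp hJ
  have key : ∀ a b, ψ ((f * g) a) * ψ b = ψ ((g * f) a) * ψ b := fun a b => by
    rw [Module.End.mul_apply, ← mul_map_end_eq_map_end_mul ψ hψ f,
      ← mul_map_end_eq_map_end_mul ψ hψ g, mul_map_end_eq_map_end_mul ψ hψ (g * f) a b |>.symm]
    rfl
  ext a
  rw [← sub_eq_zero]
  -- The difference of the two sides squares to zero in the reduced ring `R ⧸ J`.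
  have hsq := sub_eq_zero.mpr (key a ((f * g) a - (g * f) a))
  rw [← sub_mul, ← map_sub, ← pow_two] at hsq
  exact hψ ((IsReduced.eq_zero _ ⟨2, hsq⟩).trans (map_zero ψ).symm)

theorem Module.End.isReduced_of_injective_quotient {R : Type*} [CommRing R] {M : Type*}
    [AddCommGroup M] [Module R M] {J : Ideal R} (hJ : J.IsRadical) (ψ : M →ₗ[R] R ⧸ J)
    (hψ : Function.Injective ψ) : IsReduced (Module.End R M) := by
  have : IsReduced (R ⧸ J) := (Ideal.isRadical_iff_quotient_reduced J).mp hJ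
  rw [isReduced_iff_pow_one_lt 2 one_lt_two]
  intro f hf
  ext a
  have hff : f (f a) = 0 := by
    rw [← Module.End.mul_apply, ← pow_two, hf, LinearMap.zero_apply]
  have hsq : ψ (f a) ^ 2 = 0 := by
    rw [pow_two, mul_map_end_eq_map_end_mul ψ hψ, hff, map_zero, zero_mul]
  exact hψ ((IsReduced.eq_zero _ ⟨2, hsq⟩).trans (map_zero ψ).symm)

/-! ### Binary modules without embedded primes -/

theorem theoremT {R : Type*} [CommRing R] [IsNoetherianRing R]
    {M : Type*} [AddCommGroup M] [Module R M] [Module.Finite R M]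
    (hbin : IsBinaryModule R M) (hemb : ∀ p : Ideal R, ¬ IsEmbeddedPrime R M p) :
    IsSemiPrimeModule R M ∧
      (∃ I : Ideal (R ⧸ Module.annihilator R M), Nonempty (M ≃ₗ[R] I)) ∧
      (∀ f g : Module.End R M, f * g = g * f) ∧
      IsReduced (Module.End R M) := by
  have hmin : ∀ p ∈ associatedPrimes R M, ∀ q ∈ associatedPrimes R M, q ≤ p → q = p :=
    fun p hp q hq hle => hle.eq_of_not_lt fun hlt => hemb p ⟨hp, q, hq, hlt⟩
  have : Fintype (associatedPrimes R M) := (associatedPrimes.finite R M).fintype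
  have hmap : ∀ p : associatedPrimes R M, ∃ φ : M →ₗ[R] R ⧸ p.1,
      ∀ m, φ m = 0 → LocalizedModule.mkLinearMap p.1.primeCompl M m = 0 := fun p =>
    have := isSimpleModule_localizedModule hbin (p := ⟨p.1, p.2.1⟩) p.2 (hmin p.1 p.2)
    exists_linearMap_quotient_of_isSimpleModule p.1
  choose φ hφ using hmap
  have hinj : ∀ m, (∀ p, φ p m = 0) → m = 0 := fun m hm =>
    eq_zero_of_forall_associatedPrimes_mkLinearMap_eq_zero m fun p hp =>
      hφ ⟨p.asIdeal, hp⟩ m (hm _)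
  have hann := annihilator_eq_iInf_of_linearMaps _ (fun p => p.2) φ hinj
  have hrad : (Module.annihilator R M).IsRadical := by
    rw [hann]
    exact Ideal.isRadical_iInf _ fun p => p.2.1.isRadical
  obtain ⟨ψ, hψ⟩ := exists_injective_linearMap_quotient_iInf _ (fun p => p.2.1)
    (fun p q h => Subtype.ext (hmin q.1 q.2 p.1 p.2 h)) φ hinj hann
  exact ⟨hrad, exists_ideal_linearEquiv_of_injective ψ hψ,
    Module.End.mul_comm_of_injective_quotient hrad ψ hψ,
    Module.End.isReduced_of_injective_quotient hrad ψ hψ⟩
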